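/- Let $T>0$, $p\in[2,\infty)$. For a real Hilbert space $H$ and a separable, reflexive real Banach space $V$ densely (continuously and injectively) embedded in $H$, put $\mathcal H=L^2(0,T;H)$ and $\mathcal V=L^p(0,T;V)$, so that $\mathcal V\hookrightarrow\mathcal H\hookrightarrow\mathcal V^*\cong L^{p/(p-1)}(0,T;V^*)$. A bounded linear operator $M\colon H\to H$ (and likewise any bounded linear operator between Hilbert spaces) induces $(\mathcal Mu)(t)=Mu(t)$. Let $S(\tau)$, $\tau\ge 0$, be the translation semigroup on $\mathcal V^*$, $(S(\tau)u)(t)=0$ for $t\le\tau$ and $(S(\tau)u)(t)=u(t-\tau)$ for $t>\tau$, let $D(\mathrm d/\mathrm dt)$ be the set of $u\in\mathcal V^*$ for which $\frac{\mathrm d}{\mathrm dt}u:=\lim_{\tau\to0^+}\frac1\tau(I-S(\tau))u$ exists in $\mathcal V^*$, and let $\mathcal W=\{u\in\mathcal V:\mathcal Mu\in D(\mathrm d/\mathrm dt)\}$. For $k\colon\mathcal V\to[0,\infty)$, an operator $\mathcal A\colon\mathcal V\to\mathcal V^*$ is $k$-monotone if $\langle\mathcal Au-\mathcal Av,u-v\rangle\ge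 k(u-v)$ for all $u,v\in\mathcal V$. The problem set $(V,H,M,\mathcal A)$ is called proper (with function $k$) if $M$ is linear, bounded, monotone and symmetric, and $\mathcal A\colon\mathcal V\to\mathcal V^*$ maps bounded sets to bounded sets, is $k$-monotone, hemicontinuous ($\varepsilon\mapsto\langle\mathcal A(u+\varepsilon v),w\rangle$ is continuous on $[0,1]$ for all $u,v,w\in\mathcal V$) and coercive ($\langle\mathcal Au,u\rangle\to\infty$ as $\|u\|_{\mathcal V}\to\infty$). Let $(V,H,M,\mathcal A)$ and $(V_\ell,H_\ell,M_\ell,\mathcal A_\ell)$, $\ell=1,2$, be such data, with induced spaces $\mathcal V_\ell,\mathcal H_\ell,\mathcal W_\ell$, let $E_\ell\colon H_\ell\to H$ and $R_\ell\colon H\to H_\ell$ be bounded linear operators with induced operators $\mathcal E_\ell,\mathcal R_\ell$, let $f\in\mathcal V^*$, $f_\ell\in\mathcal V_\ell^*$, and set $$\mathcal Fu=\tfrac{\mathrm d}{\mathrm dt}\mathcal Mu+\mathcal Au+f\in\mathcal V^*\quad(u\in\mathcal W),$$ $$D(\mathcal F_\ell)=\{u\in\mathcal H:\ \mathcal R_\ell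 u\in\mathcal W_\ell,\ (\tfrac{\mathrm d}{\mathrm dt}\mathcal M_\ell+\mathcal A_\ell)\mathcal R_\ell u+f_\ell\in\mathcal H_\ell\},\qquad \mathcal F_\ell u=\mathcal E_\ell\bigl((\tfrac{\mathrm d}{\mathrm dt}\mathcal M_\ell+\mathcal A_\ell)\mathcal R_\ell u+f_\ell\bigr).$$ Assume: 1. All problem sets are proper, $\mathcal A_\ell$ being $k_\ell$-monotone with $k_\ell\colon\mathcal V_\ell\to[0,\infty)$; $R_\ell E_\ell=I$ on $H_\ell$ and $(E_\ell x,y)_H=(x,R_\ell y)_{H_\ell}$ for all $x\in H_\ell,y\in H$; and $M=E_1M_1R_1+E_2M_2R_2$. 2. $R_\ell$ is bounded from $V$ to $V_\ell$; and if $x\in H$ satisfies $R_\ell x\in V_\ell$ for $\ell=1,2$, then $x\in V$ and $\|x\|_V^p\le C\sum_{\ell}\|R_\ell x\|_{V_\ell}^p$, with $C$ independent of $x$. 3. $\mathcal Fu=\mathcal F_1u+\mathcal F_2u$ in $\mathcal H$ for every $u\in D(\mathcal F_1)\cap D(\mathcal F_2)$. 4. $u\in\mathcal W$ is a solution of $\mathcal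 Fu=0$ and $u\in D(\mathcal F_1)\cap D(\mathcal F_2)$. Let $s>0$, $u_2^0\in D(\mathcal F_2)$, and let $u_1^{n+1}\in D(\mathcal F_1)$, $u_2^{n+1}\in D(\mathcal F_2)$, $n\ge0$, satisfy either the Peaceman--Rachford scheme $$(sI+\mathcal F_1)u_1^{n+1}=(sI-\mathcal F_2)u_2^n,\qquad (sI+\mathcal F_2)u_2^{n+1}=(sI-\mathcal F_1)u_1^{n+1}\qquad(n\ge0),$$ or the Douglas--Rachford scheme $$(sI+\mathcal F_1)u_1^{n+1}=(sI-\mathcal F_2)u_2^n,\qquad (sI+\mathcal F_2)u_2^{n+1}=su_1^{n+1}+\mathcal F_2u_2^n\qquad(n\ge0).$$ Then $$\lim_{n\to\infty}\Bigl(k_1\bigl(\mathcal R_1(u_1^n-u)\bigr)+k_2\bigl(\mathcal R_2(u_2^n-u)\bigr)\Bigr)=0.$$ -/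

import Mathlib

open Filter Topology MeasureTheory
open scoped ENNReal NNReal

noncomputable section

namespace SchwarzLike

instance instFactOneLe {p : ℝ≥0∞} [h : Fact (2 ≤ p)] : Fact (1 ≤ p) :=
  ⟨le_trans one_le_two h.out⟩

/-- Lebesgue measure on the time interval `(0, T)`. -/
abbrev timeMeasure (T : ℝ) : Measure ℝ := volume.restrict (Set.Ioo 0 T)

/-- The Bochner space `L^p(0, T; X)`. -/
abbrev LpTime (T : ℝ) (p : ℝ≥0∞) (X : Type*) [NormedAddCommGroup X] :=
  Lp X p (timeMeasure T)

section TimeSpaces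

variable {T : ℝ} {p : ℝ≥0∞} {X Y : Type*} [NormedAddCommGroup X] [NormedSpace ℝ X]
  [NormedAddCommGroup Y] [NormedSpace ℝ Y]

/-- The operator `L^p(0, T; X) → L^p(0, T; Y)`, `u ↦ (t ↦ L (u t))`, induced by `L : X → Y`. -/
def induced (T : ℝ) (p : ℝ≥0∞) [Fact (1 ≤ p)] (L : X →L[ℝ] Y) :
    LpTime T p X →L[ℝ] LpTime T p Y :=
  L.compLpL p (timeMeasure T)

theorem memLp_two {T : ℝ} {p : ℝ≥0∞} [h : Fact (2 ≤ p)] {X : Type*} [NormedAddCommGroup X]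
    (u : LpTime T p X) : MemLp u 2 (timeMeasure T) :=
  (Lp.memLp u).mono_exponent h.out

/-- The inclusion `L^p(0, T; X) ⊆ L^2(0, T; X)` for `p ≥ 2`. -/
def toL2 (T : ℝ) (p : ℝ≥0∞) [Fact (2 ≤ p)] (X : Type*) [NormedAddCommGroup X]
    [NormedSpace ℝ X] : LpTime T p X →L[ℝ] LpTime T 2 X :=
  LinearMap.mkContinuous
    { toFun := fun u => (memLp_two u).toLp u
      map_add' := fun u v => by
        refine Lp.ext ?_
        filter_upwards [(memLp_two (u + v)).coeFn_toLp, (memLp_two u).coeFn_toLp,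
          (memLp_two v).coeFn_toLp, Lp.coeFn_add u v,
          Lp.coeFn_add ((memLp_two u).toLp u) ((memLp_two v).toLp v)] with t h1 h2 h3 h4 h5
        rw [h1, h5, h4, Pi.add_apply, Pi.add_apply, h2, h3]
      map_smul' := fun c u => by
        refine Lp.ext ?_
        filter_upwards [(memLp_two (c • u)).coeFn_toLp, (memLp_two u).coeFn_toLp,
          Lp.coeFn_smul c u, Lp.coeFn_smul c ((memLp_two u).toLp u)] with t h1 h2 h3 h4
        rw [h1, RingHom.id_apply, h4, h3, Pi.smul_apply, Pi.smul_apply, h2] }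
    (timeMeasure T Set.univ ^ (1 / (2 : ℝ≥0∞).toReal - 1 / p.toReal)).toReal
    (fun u => by
      have hexp : 0 ≤ 1 / (2 : ℝ≥0∞).toReal - 1 / p.toReal := by
        have hp : 2 ≤ p := Fact.out
        rcases eq_or_ne p ∞ with rfl | hne
        · simp
        · have : (2 : ℝ≥0∞).toReal ≤ p.toReal := ENNReal.toReal_mono hne hp
          have h2 : (0 : ℝ) < (2 : ℝ≥0∞).toReal := by simp
          exact sub_nonneg.2 (one_div_le_one_div_of_le h2 this)
      have hle := eLpNorm_le_eLpNorm_mul_rpow_measure_univ (μ := timeMeasure T)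
        (Fact.out : 2 ≤ p) (Lp.aestronglyMeasurable u)
      change ‖(memLp_two u).toLp u‖ ≤ _
      rw [Lp.norm_toLp, Lp.norm_def, mul_comm, ← ENNReal.toReal_mul]
      refine ENNReal.toReal_mono ?_ hle
      exact ENNReal.mul_ne_top (Lp.eLpNorm_ne_top u)
        (ENNReal.rpow_ne_top_of_nonneg hexp (measure_ne_top _ _)))

theorem memLp_leftShift {T : ℝ} {p : ℝ≥0∞} {X : Type*} [NormedAddCommGroup X] (τ : ℝ)
    (u : LpTime T p X) :
    MemLp (fun t => (Set.Ioo 0 T).indicator (u : ℝ → X) (t + τ)) p (timeMeasure T) :=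
  (((memLp_indicator_iff_restrict measurableSet_Ioo).2 (Lp.memLp u)).comp_measurePreserving
    (measurePreserving_add_right volume τ)).restrict _

theorem indicator_congr_shift {T : ℝ} {X : Type*} [NormedAddCommGroup X] (τ : ℝ) {f g : ℝ → X}
    (h : f =ᵐ[timeMeasure T] g) :
    ∀ᵐ t ∂(timeMeasure T), (Set.Ioo 0 T).indicator f (t + τ) =
      (Set.Ioo 0 T).indicator g (t + τ) :=
  ae_restrict_of_ae <| (measurePreserving_add_right volume τ).quasiMeasurePreserving.ae
    ((ae_eq_restrict_iff_indicator_ae_eq measurableSet_Ioo).1 h)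

/-- The left translation on `L^p(0, T; X)`: for `0 ≤ τ` it maps `u` to the function
`t ↦ u (t + τ)` for `t < T - τ` and `t ↦ 0` for `t ≥ T - τ`. -/
def leftShift (T : ℝ) (p : ℝ≥0∞) [Fact (1 ≤ p)] (X : Type*) [NormedAddCommGroup X]
    [NormedSpace ℝ X] (τ : ℝ) : LpTime T p X →L[ℝ] LpTime T p X :=
  LinearMap.mkContinuous
    { toFun := fun u => (memLp_leftShift τ u).toLp _
      map_add' := fun u v => by
        refine Lp.ext ?_
        filter_upwards [(memLp_leftShift τ (u + v)).coeFn_toLp, (memLp_leftShift τ u).coeFn_toLp,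
          (memLp_leftShift τ v).coeFn_toLp, indicator_congr_shift τ (Lp.coeFn_add u v),
          Lp.coeFn_add ((memLp_leftShift τ u).toLp _) ((memLp_leftShift τ v).toLp _)]
          with t h1 h2 h3 h4 h5
        rw [h1, h5, h4, Pi.add_apply, h2, h3, Set.indicator_add', Pi.add_apply]
      map_smul' := fun c u => by
        refine Lp.ext ?_
        filter_upwards [(memLp_leftShift τ (c • u)).coeFn_toLp, (memLp_leftShift τ u).coeFn_toLp,
          indicator_congr_shift τ (Lp.coeFn_smul c u),
          Lp.coeFn_smul c ((memLp_leftShift τ u).toLp _)] with t h1 h2 h3 h4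
        rw [h1, RingHom.id_apply, h4, h3, Pi.smul_apply, h2]
        exact Set.indicator_const_smul_apply (Set.Ioo 0 T) c (u : ℝ → X) (t + τ) }
    1
    (fun u => by
      change ‖(memLp_leftShift τ u).toLp _‖ ≤ _
      rw [Lp.norm_toLp, one_mul, Lp.norm_def]
      refine ENNReal.toReal_mono (Lp.eLpNorm_ne_top u) ?_
      have hmem := (memLp_indicator_iff_restrict measurableSet_Ioo).2 (Lp.memLp u)
      refine (eLpNorm_mono_measure _ Measure.restrict_le_self).trans ?_
      have h := eLpNorm_comp_measurePreserving (p := p) hmem.aestronglyMeasurable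
        (measurePreserving_add_right (volume : Measure ℝ) τ)
      rw [eLpNorm_indicator_eq_eLpNorm_restrict measurableSet_Ioo] at h
      exact h.le)

/-- The translation semigroup `S(τ)`, `τ ≥ 0`, on the dual of `L^p(0, T; X)`. For a functional
`v ↦ ∫₀ᵀ ⟨u(t), v(t)⟩ dt` the functional `S(τ)u` is
`v ↦ ∫₀^{T-τ} ⟨u(t), v(t + τ)⟩ dt = ∫_τᵀ ⟨u(t - τ), v(t)⟩ dt`, so that `S(τ)u` is represented by
the function that is `0` on `(0, τ]` and `t ↦ u(t - τ)` on `(τ, T)`. -/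
def translation (τ : ℝ) [Fact (1 ≤ p)] (u : StrongDual ℝ (LpTime T p X)) :
    StrongDual ℝ (LpTime T p X) :=
  u.comp (leftShift T p X τ)

/-- `z` is the limit of `τ⁻¹ (I - S(τ)) u` in the dual of `L^p(0, T; X)` as `τ → 0+`. -/
def HasTimeDeriv [Fact (1 ≤ p)] (u z : StrongDual ℝ (LpTime T p X)) : Prop :=
  Tendsto (fun τ : ℝ => τ⁻¹ • (u - translation τ u)) (𝓝[>] 0) (𝓝 z)

/-- The domain `D(d/dt)` in the dual of `L^p(0, T; X)`. -/
def timeDerivDomain (T : ℝ) (p : ℝ≥0∞) [Fact (1 ≤ p)] (X : Type*) [NormedAddCommGroup X]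
    [NormedSpace ℝ X] : Set (StrongDual ℝ (LpTime T p X)) :=
  {u | ∃ z, HasTimeDeriv u z}

/-- The operator `d/dt`; it is meaningful on `timeDerivDomain`. -/
def timeDeriv [Fact (1 ≤ p)] (u : StrongDual ℝ (LpTime T p X)) :
    StrongDual ℝ (LpTime T p X) :=
  limUnder (𝓝[>] (0 : ℝ)) (fun τ : ℝ => τ⁻¹ • (u - translation τ u))

end TimeSpaces

section Operators

variable {B : Type*} [NormedAddCommGroup B] [NormedSpace ℝ B]

/-- `G` maps bounded sets into bounded sets. -/
def IsBoundedOperator (G : B → StrongDual ℝ B) : Prop :=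
  ∀ s : Set B, Bornology.IsBounded s → Bornology.IsBounded (G '' s)

def IsKMonotone (k : B → ℝ≥0) (G : B → StrongDual ℝ B) : Prop :=
  ∀ u v : B, (k (u - v) : ℝ) ≤ (G u - G v) (u - v)

def IsHemicontinuous (G : B → StrongDual ℝ B) : Prop :=
  ∀ u v w : B, ContinuousOn (fun ε : ℝ => G (u + ε • v) w) (Set.Icc 0 1)

/-- `⟨G u, u⟩ → ∞` as `‖u‖ → ∞`. -/
def IsCoerciveOperator (G : B → StrongDual ℝ B) : Prop :=
  Tendsto (fun u : B => G u u) (comap norm atTop) atTop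

end Operators

/-- The data of a nonlinear Cauchy problem `d/dt ℳ u + 𝒜 u + f = 0` on `(0, T)`:
the embedding `j` of `V` into `H`, the operator `M` on `H`, the operator `𝒜` from
`𝒱 = L^p(0, T; V)` to its dual, and the source term `f` in the dual of `𝒱`. -/
structure CauchyProblem (T : ℝ) (p : ℝ≥0∞) [Fact (2 ≤ p)] (H V : Type*)
    [NormedAddCommGroup H] [InnerProductSpace ℝ H] [NormedAddCommGroup V] [NormedSpace ℝ V] where
  j : V →L[ℝ] H
  M : H →L[ℝ] H
  A : LpTime T p V → StrongDual ℝ (LpTime T p V)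
  f : StrongDual ℝ (LpTime T p V)

namespace CauchyProblem

variable {T : ℝ} {p : ℝ≥0∞} [Fact (2 ≤ p)] {H V : Type*}
  [NormedAddCommGroup H] [InnerProductSpace ℝ H] [NormedAddCommGroup V] [NormedSpace ℝ V]

/-- The problem set `(V, H, M, 𝒜)` is proper, where `𝒜` is `k`-monotone for the given `k`. The
completeness of `V` and `H` is part of the ambient assumptions on these spaces. -/
structure IsProper (P : CauchyProblem T p H V) (k : LpTime T p V → ℝ≥0) : Prop where
  separable : TopologicalSpace.SeparableSpace V
  reflexive : Function.Surjective (NormedSpace.inclusionInDoubleDual ℝ V)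
  embedding_injective : Function.Injective P.j
  embedding_dense : DenseRange P.j
  M_monotone : ∀ x : H, 0 ≤ inner ℝ (P.M x) x
  M_symmetric : ∀ x y : H, inner ℝ (P.M x) y = inner ℝ (P.M y) x
  A_bounded : IsBoundedOperator P.A
  A_kMonotone : IsKMonotone k P.A
  A_hemicontinuous : IsHemicontinuous P.A
  A_coercive : IsCoerciveOperator P.A

/-- The embedding `𝒱 = L^p(0, T; V) ↪ ℋ = L^2(0, T; H)`. -/
def embed (P : CauchyProblem T p H V) : LpTime T p V →L[ℝ] LpTime T 2 H :=
  (toL2 T p H).comp (induced T p P.j)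

/-- The embedding `ℋ ↪ 𝒱*`, `h ↦ (h, ·)_ℋ`. -/
def embedDual (P : CauchyProblem T p H V) (h : LpTime T 2 H) : StrongDual ℝ (LpTime T p V) :=
  (innerSL ℝ h).comp P.embed

/-- The element of `𝒱` identified with a given element of `ℋ` (arbitrary if there is none). -/
def toV (P : CauchyProblem T p H V) : LpTime T 2 H → LpTime T p V :=
  Function.invFun P.embed

/-- The element of `ℋ` identified with a given element of `𝒱*` (arbitrary if there is none). -/
def toH (P : CauchyProblem T p H V) : StrongDual ℝ (LpTime T p V) → LpTime T 2 H :=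
  Function.invFun P.embedDual

/-- `ℳ u` as an element of `𝒱*`, for `u ∈ 𝒱`. -/
def Mdual (P : CauchyProblem T p H V) (u : LpTime T p V) : StrongDual ℝ (LpTime T p V) :=
  P.embedDual (induced T 2 P.M (P.embed u))

/-- The space `𝒲 = {u ∈ 𝒱 : ℳ u ∈ D(d/dt)}`. -/
def W (P : CauchyProblem T p H V) : Set (LpTime T p V) :=
  {u | P.Mdual u ∈ timeDerivDomain T p V}

/-- `(d/dt ℳ + 𝒜) u + f ∈ 𝒱*`, for `u ∈ 𝒲`. -/
def cauchyOp (P : CauchyProblem T p H V) (u : LpTime T p V) : StrongDual ℝ (LpTime T p V) :=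
  timeDeriv (P.Mdual u) + P.A u + P.f

/-- `u` solves the nonlinear Cauchy problem `ℱ u = 0` in `𝒱*`. -/
def IsSolution (P : CauchyProblem T p H V) (u : LpTime T p V) : Prop :=
  u ∈ P.W ∧ P.cauchyOp u = 0

end CauchyProblem

section Decomposition

variable {T : ℝ} {p : ℝ≥0∞} [Fact (2 ≤ p)] {H V : Type*}
  [NormedAddCommGroup H] [InnerProductSpace ℝ H] [NormedAddCommGroup V] [NormedSpace ℝ V]

/-- The domain `D(ℱ_ℓ)` in `ℋ` of the decomposed operator that belongs to the local problem `Q`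
with spaces `H'`, `V'`, and to the restriction operator `R : H → H'`. -/
def subDomain {H' V' : Type*} [NormedAddCommGroup H'] [InnerProductSpace ℝ H']
    [NormedAddCommGroup V'] [NormedSpace ℝ V'] (Q : CauchyProblem T p H' V') (R : H →L[ℝ] H') :
    Set (LpTime T 2 H) :=
  {u | ∃ w ∈ Q.W, Q.embed w = induced T 2 R u ∧ ∃ g : LpTime T 2 H', Q.embedDual g = Q.cauchyOp w}

/-- The operator `ℱ_ℓ u = ℰ_ℓ ((d/dt ℳ_ℓ + 𝒜_ℓ) ℛ_ℓ u + f_ℓ)`; it is meaningful on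
`subDomain Q R`. -/
def subOp {H' V' : Type*} [NormedAddCommGroup H'] [InnerProductSpace ℝ H']
    [NormedAddCommGroup V'] [NormedSpace ℝ V'] (Q : CauchyProblem T p H' V')
    (E : H' →L[ℝ] H) (R : H →L[ℝ] H') (u : LpTime T 2 H) : LpTime T 2 H :=
  induced T 2 E (Q.toH (Q.cauchyOp (Q.toV (induced T 2 R u))))

variable {ι : Type*} [Fintype ι] {Hl Vl : ι → Type*}
  [∀ ℓ, NormedAddCommGroup (Hl ℓ)] [∀ ℓ, InnerProductSpace ℝ (Hl ℓ)]
  [∀ ℓ, NormedAddCommGroup (Vl ℓ)] [∀ ℓ, NormedSpace ℝ (Vl ℓ)]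

/-- All problem sets are proper, `R_ℓ E_ℓ = I`, `E_ℓ` and `R_ℓ` are adjoint to each other, and
`M = ∑ E_ℓ M_ℓ R_ℓ`. -/
structure ProperDecomposition (P : CauchyProblem T p H V)
    (Q : ∀ ℓ, CauchyProblem T p (Hl ℓ) (Vl ℓ))
    (E : ∀ ℓ, Hl ℓ →L[ℝ] H) (R : ∀ ℓ, H →L[ℝ] Hl ℓ)
    (k₀ : LpTime T p V → ℝ≥0) (k : ∀ ℓ, LpTime T p (Vl ℓ) → ℝ≥0) : Prop where
  proper : P.IsProper k₀
  proper_sub : ∀ ℓ, (Q ℓ).IsProper (k ℓ)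
  restrict_extend : ∀ ℓ (x : Hl ℓ), R ℓ (E ℓ x) = x
  adjoint : ∀ ℓ (x : Hl ℓ) (y : H), inner ℝ (E ℓ x) y = inner ℝ x (R ℓ y)
  sum_M : ∀ x : H, P.M x = ∑ ℓ, E ℓ ((Q ℓ).M (R ℓ x))

/-- Each `R_ℓ` is bounded from `V` to `V_ℓ`, and each `u ∈ H` with `R_ℓ u ∈ V_ℓ` for all `ℓ` is
in `V`, with `‖u‖_V^p ≤ C ∑ ‖R_ℓ u‖_{V_ℓ}^p`. -/
structure CompatibleSpaces (P : CauchyProblem T p H V)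
    (Q : ∀ ℓ, CauchyProblem T p (Hl ℓ) (Vl ℓ)) (R : ∀ ℓ, H →L[ℝ] Hl ℓ) : Prop where
  bounded : ∀ ℓ, ∃ C : ℝ, ∀ v : V, ∃ w : Vl ℓ, (Q ℓ).j w = R ℓ (P.j v) ∧ ‖w‖ ≤ C * ‖v‖
  glue : ∃ C : ℝ, ∀ (x : H) (w : ∀ ℓ, Vl ℓ), (∀ ℓ, (Q ℓ).j (w ℓ) = R ℓ x) →
    ∃ v : V, P.j v = x ∧ ‖v‖ ^ p.toReal ≤ C * ∑ ℓ, ‖w ℓ‖ ^ p.toReal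

/-- The identity `ℱ u = ∑ ℱ_ℓ u` in `ℋ` for all `u ∈ ⋂ D(ℱ_ℓ)`, where `u ∈ 𝒲`. -/
def SumIdentity (P : CauchyProblem T p H V)
    (Q : ∀ ℓ, CauchyProblem T p (Hl ℓ) (Vl ℓ))
    (E : ∀ ℓ, Hl ℓ →L[ℝ] H) (R : ∀ ℓ, H →L[ℝ] Hl ℓ) : Prop :=
  ∀ u ∈ P.W, (∀ ℓ, P.embed u ∈ subDomain (Q ℓ) (R ℓ)) →
    P.cauchyOp u = P.embedDual (∑ ℓ, subOp (Q ℓ) (E ℓ) (R ℓ) (P.embed u))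

end Decomposition

section Schemes

variable {X : Type*} [NormedAddCommGroup X] [NormedSpace ℝ X]

/-- The Peaceman--Rachford scheme with parameter `s` for operators `F₁ : D₁ → X`, `F₂ : D₂ → X`
(the value `u₁ 0` plays no role). -/
structure IsPeacemanRachford (s : ℝ) (D₁ D₂ : Set X) (F₁ F₂ : X → X) (u₁ u₂ : ℕ → X) : Prop where
  mem₁ : ∀ n, u₁ (n + 1) ∈ D₁
  mem₂ : ∀ n, u₂ (n + 1) ∈ D₂
  step₁ : ∀ n, s • u₁ (n + 1) + F₁ (u₁ (n + 1)) = s • u₂ n - F₂ (u₂ n)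
  step₂ : ∀ n, s • u₂ (n + 1) + F₂ (u₂ (n + 1)) = s • u₁ (n + 1) - F₁ (u₁ (n + 1))

/-- The Douglas--Rachford scheme with parameter `s` for operators `F₁ : D₁ → X`, `F₂ : D₂ → X`
(the value `u₁ 0` plays no role). -/
structure IsDouglasRachford (s : ℝ) (D₁ D₂ : Set X) (F₁ F₂ : X → X) (u₁ u₂ : ℕ → X) : Prop where
  mem₁ : ∀ n, u₁ (n + 1) ∈ D₁
  mem₂ : ∀ n, u₂ (n + 1) ∈ D₂
  step₁ : ∀ n, s • u₁ (n + 1) + F₁ (u₁ (n + 1)) = s • u₂ n - F₂ (u₂ n)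
  step₂ : ∀ n, s • u₂ (n + 1) + F₂ (u₂ (n + 1)) = s • u₁ (n + 1) + F₂ (u₂ n)

end Schemes

end SchwarzLike

end

/-!
The scheme is a Lions–Mercier splitting for two monotone operators on `L²(0, T; H)`, and the
solution `u` enters through `F₁ u + F₂ u = 0`.

*Monotonicity.* For `h ∈ L²(0, T; H)` the form `(M h, h)` does not increase under translation, so
Cauchy–Schwarz for the semi-inner product of `M` gives `(M h, L h) ≤ (M h, h)` for the left
translation `L` (`inner_induced_leftShift_le`). Dividing by the step and passing to the limit,
`⟨d/dt ℳ w, w⟩ ≥ 0` for `w ∈ 𝒲` (`CauchyProblem.timeDeriv_Mdual_nonneg`). As `E_ℓ` is the adjoint of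
`R_ℓ`, the `k_ℓ`-monotonicity of `𝒜_ℓ` carries over to `ℱ_ℓ` (`kMonotone_subOp`).

*Convergence.* In both schemes `zₙ = (s + F₂) u₂ⁿ - (s + F₂) u` satisfies an energy estimate in which
`‖zₙ‖²` decreases by at least a multiple of the two monotonicity pairings
(`IsPeacemanRachford.norm_sq_add_le`, `IsDouglasRachford.norm_sq_add_le`), so these pairings tend
to `0`.

Elements of `ℋ` that lie in `𝒱`, and elements of `𝒱*` that lie in `ℋ`, are recovered without
ambiguity because both embeddings are injective (`CauchyProblem.embed_injective`,
`CauchyProblem.embedDual_injective`); the second follows from the density of `V` in `H` by testing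
with indicator functions. The same injectivity turns `ℱ u = 0` in `𝒱*` into `F₁ u + F₂ u = 0`.
-/

namespace SchwarzLike

/-! ### Induced operators, indicator functions and translations in Bochner spaces -/

section Bochner

variable {T : ℝ} {p : ℝ≥0∞} {X Y : Type*} [NormedAddCommGroup X] [NormedSpace ℝ X]
  [NormedAddCommGroup Y] [NormedSpace ℝ Y]

theorem coeFn_induced [Fact (1 ≤ p)] (L : X →L[ℝ] Y) (u : LpTime T p X) :
    induced T p L u =ᵐ[timeMeasure T] fun t => L (u t) :=
  L.coeFn_compLpL u

theorem coeFn_toL2 [Fact (2 ≤ p)] (u : LpTime T p X) : toL2 T p X u =ᵐ[timeMeasure T] u :=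
  (memLp_two u).coeFn_toLp

theorem coeFn_leftShift [Fact (1 ≤ p)] (τ : ℝ) (u : LpTime T p X) :
    leftShift T p X τ u =ᵐ[timeMeasure T]
      fun t => (Set.Ioo 0 T).indicator (u : ℝ → X) (t + τ) :=
  (memLp_leftShift τ u).coeFn_toLp

end Bochner

theorem continuous_indicatorConstLp {α X : Type*} [MeasurableSpace α] {μ : Measure α}
    [NormedAddCommGroup X] {p : ℝ≥0∞} [Fact (1 ≤ p)] {S : Set α} (hS : MeasurableSet S)
    (hμS : μ S ≠ ∞) : Continuous fun c : X => indicatorConstLp p hS hμS c :=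
  AddMonoidHomClass.continuous_of_bound
    (AddMonoidHom.mk' (fun c : X => indicatorConstLp p hS hμS c) fun _ _ =>
      indicatorConstLp_add.symm) (μ.real S ^ (1 / p.toReal))
    fun _ => (norm_indicatorConstLp_le (hs := hS) (hμs := hμS)).trans_eq (mul_comm _ _)

section Hilbert

variable {T : ℝ} {H K : Type*} [NormedAddCommGroup H] [InnerProductSpace ℝ H]
  [NormedAddCommGroup K] [InnerProductSpace ℝ K]

theorem inner_induced_left (E : K →L[ℝ] H) (R : H →L[ℝ] K)
    (h : ∀ x y, inner ℝ (E x) y = inner ℝ x (R y)) (x : LpTime T 2 K) (y : LpTime T 2 H) :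
    inner ℝ (induced T 2 E x) y = inner ℝ x (induced T 2 R y) := by
  rw [L2.inner_def, L2.inner_def]
  refine integral_congr_ae ?_
  filter_upwards [coeFn_induced E x, coeFn_induced R y] with t h1 h2
  rw [h1, h2, h]

theorem inner_induced_nonneg (M : H →L[ℝ] H) (hM : ∀ x, 0 ≤ inner ℝ (M x) x)
    (x : LpTime T 2 H) : 0 ≤ inner ℝ (induced T 2 M x) x := by
  rw [L2.inner_def]
  refine integral_nonneg_of_ae ?_
  filter_upwards [coeFn_induced M x] with t h1
  rw [h1]
  exact hM _

/-- The quadratic form of a monotone operator only loses mass under the left translation, which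
discards part of the time interval. -/
theorem inner_induced_leftShift_self_le (M : H →L[ℝ] H) (hM : ∀ x, 0 ≤ inner ℝ (M x) x)
    (τ : ℝ) (h : LpTime T 2 H) :
    inner ℝ (induced T 2 M (leftShift T 2 H τ h)) (leftShift T 2 H τ h) ≤
      inner ℝ (induced T 2 M h) h := by
  set φ : ℝ → ℝ := (Set.Ioo 0 T).indicator fun t => inner ℝ (M (h t)) (h t) with hφ
  have hint : Integrable (fun t => inner ℝ (M (h t)) (h t)) (timeMeasure T) :=
    (L2.integrable_inner (𝕜 := ℝ) (induced T 2 M h) h).congr <| by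
      filter_upwards [coeFn_induced M h] with t h1
      rw [h1]
  have hφint : Integrable φ := (integrable_indicator_iff measurableSet_Ioo).2 hint
  have hφ0 : ∀ t, 0 ≤ φ t := fun t => Set.indicator_nonneg (fun _ _ => hM _) t
  have hleft : inner ℝ (induced T 2 M (leftShift T 2 H τ h)) (leftShift T 2 H τ h) =
      ∫ t in Set.Ioo 0 T, φ (t + τ) := by
    rw [L2.inner_def]
    refine integral_congr_ae ?_
    filter_upwards [coeFn_induced M (leftShift T 2 H τ h), coeFn_leftShift τ h] with t h1 h2
    rw [h1, h2]
    by_cases ht : t + τ ∈ Set.Ioo 0 T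
    · simp only [hφ, Set.indicator_of_mem ht]
    · simp only [hφ, Set.indicator_of_notMem ht, inner_zero_right]
  have hright : inner ℝ (induced T 2 M h) h = ∫ t, φ t := by
    rw [L2.inner_def, hφ, integral_indicator measurableSet_Ioo]
    refine integral_congr_ae ?_
    filter_upwards [coeFn_induced M h] with t h1
    rw [h1]
  rw [hleft, hright, ← integral_add_right_eq_self φ τ]
  exact setIntegral_le_integral (hφint.comp_add_right τ) (Eventually.of_forall fun t => hφ0 _)

/-- Translation is a contraction for the semi-inner product of a symmetric monotone `M`. -/
theorem inner_induced_leftShift_le (M : H →L[ℝ] H) (hM : ∀ x, 0 ≤ inner ℝ (M x) x)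
    (hsymm : ∀ x y, inner ℝ (M x) y = inner ℝ (M y) x) (τ : ℝ) (h : LpTime T 2 H) :
    inner ℝ (induced T 2 M h) (leftShift T 2 H τ h) ≤ inner ℝ (induced T 2 M h) h := by
  set g := leftShift T 2 H τ h with hg
  have h1 := inner_induced_nonneg M hM (h - g)
  have h2 := inner_induced_leftShift_self_le M hM τ h
  have h3 : inner ℝ (induced T 2 M g) h = inner ℝ (induced T 2 M h) g := by
    rw [inner_induced_left M M (fun x y => by rw [hsymm, real_inner_comm]), real_inner_comm]
  rw [map_sub, inner_sub_left, inner_sub_right, inner_sub_right, h3] at h1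
  linarith

end Hilbert

/-! ### The time derivative -/

section TimeDerivative

variable {T : ℝ} {p : ℝ≥0∞} {X : Type*} [NormedAddCommGroup X] [NormedSpace ℝ X]
  [Fact (1 ≤ p)] {u v z w : StrongDual ℝ (LpTime T p X)}

theorem HasTimeDeriv.timeDeriv_eq (h : HasTimeDeriv u z) : timeDeriv u = z :=
  h.limUnder_eq

theorem hasTimeDeriv_timeDeriv (h : u ∈ timeDerivDomain T p X) :
    HasTimeDeriv u (timeDeriv u) := by
  obtain ⟨z, hz⟩ := h
  rwa [hz.timeDeriv_eq]

theorem HasTimeDeriv.sub (hu : HasTimeDeriv u z) (hv : HasTimeDeriv v w) :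
    HasTimeDeriv (u - v) (z - w) := by
  refine (Tendsto.sub hu hv).congr fun τ => ?_
  ext x
  simp only [translation, sub_apply, smul_apply,
    ContinuousLinearMap.comp_apply, smul_eq_mul]
  ring

end TimeDerivative

/-! ### The embeddings of `𝒱` into `ℋ` and of `ℋ` into `𝒱*` -/

namespace CauchyProblem

variable {T : ℝ} {p : ℝ≥0∞} [Fact (2 ≤ p)] {H V : Type*}
  [NormedAddCommGroup H] [InnerProductSpace ℝ H] [NormedAddCommGroup V] [NormedSpace ℝ V]
  (P : CauchyProblem T p H V)

theorem coeFn_embed (u : LpTime T p V) :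
    P.embed u =ᵐ[timeMeasure T] fun t => P.j (u t) :=
  (coeFn_toL2 _).trans (coeFn_induced P.j u)

theorem embedDual_apply (h : LpTime T 2 H) (v : LpTime T p V) :
    P.embedDual h v = inner ℝ h (P.embed v) :=
  rfl

theorem embedDual_sub (g h : LpTime T 2 H) :
    P.embedDual (g - h) = P.embedDual g - P.embedDual h := by
  ext v
  simp only [embedDual_apply, sub_apply, inner_sub_left]

theorem Mdual_sub (u v : LpTime T p V) : P.Mdual (u - v) = P.Mdual u - P.Mdual v := by
  simp only [Mdual, map_sub, embedDual_sub]

theorem embed_leftShift (τ : ℝ) (u : LpTime T p V) :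
    P.embed (leftShift T p V τ u) = leftShift T 2 H τ (P.embed u) := by
  refine Lp.ext ?_
  filter_upwards [P.coeFn_embed (leftShift T p V τ u), coeFn_leftShift τ u,
    coeFn_leftShift τ (P.embed u), indicator_congr_shift τ (P.coeFn_embed u)] with t h1 h2 h3 h4
  rw [h1, h2, h3, h4]
  by_cases ht : t + τ ∈ Set.Ioo 0 T
  · simp only [Set.indicator_of_mem ht]
  · simp only [Set.indicator_of_notMem ht, map_zero]

theorem embed_indicatorConstLp {S : Set ℝ} (hS : MeasurableSet S) (x : V) :
    P.embed (indicatorConstLp p hS (measure_ne_top (timeMeasure T) S) x) =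
      indicatorConstLp 2 hS (measure_ne_top (timeMeasure T) S) (P.j x) := by
  refine Lp.ext ?_
  filter_upwards [P.coeFn_embed (indicatorConstLp p hS (measure_ne_top (timeMeasure T) S) x),
    indicatorConstLp_coeFn (p := p) (hs := hS) (hμs := measure_ne_top (timeMeasure T) S) (c := x),
    indicatorConstLp_coeFn (p := 2) (hs := hS) (hμs := measure_ne_top (timeMeasure T) S)
      (c := P.j x)] with t h1 h2 h3
  rw [h1, h2, h3]
  by_cases ht : t ∈ S
  · simp only [Set.indicator_of_mem ht]
  · simp only [Set.indicator_of_notMem ht, map_zero]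

variable {P}

theorem embed_injective (hj : Function.Injective P.j) : Function.Injective P.embed := by
  intro u v huv
  refine Lp.ext ?_
  have h1 := P.coeFn_embed u
  rw [huv] at h1
  filter_upwards [h1, P.coeFn_embed v] with t h1 h2
  exact hj (h1.symm.trans h2)

/-- An element of `ℋ` that vanishes on `𝒱` is orthogonal to all indicator functions with values in
the range of `j`, hence by density to all of `ℋ`. -/
theorem embedDual_injective (hj : DenseRange P.j) : Function.Injective P.embedDual := by
  intro g h hgh
  have key : ∀ x : LpTime T 2 H, inner ℝ (g - h) x = 0 := by
    refine Lp.induction (by simp) (motive := fun x : LpTime T 2 H => inner ℝ (g - h) x = 0)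
      ?_ ?_ ?_
    · intro c S hS hμS
      have hcont : Continuous fun c : H =>
          inner ℝ (g - h) (indicatorConstLp (μ := timeMeasure T) 2 hS hμS.ne c) :=
        (innerSL ℝ (g - h)).continuous.comp (continuous_indicatorConstLp hS hμS.ne)
      refine hj.induction_on (p := fun c => inner ℝ (g - h)
        (indicatorConstLp (μ := timeMeasure T) 2 hS hμS.ne c) = 0) c
        (isClosed_eq hcont continuous_const) fun x => ?_
      rw [← P.embed_indicatorConstLp hS x, ← embedDual_apply, embedDual_sub, hgh, sub_self,
        zero_apply]
    · intro f f' hf hf' _ h1 h2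
      rw [inner_add_right, h1, h2, add_zero]
    · exact isClosed_eq (innerSL ℝ (g - h)).continuous continuous_const
  exact sub_eq_zero.1 (inner_self_eq_zero.1 (key (g - h)))

theorem toV_embed (hj : Function.Injective P.j) (u : LpTime T p V) : P.toV (P.embed u) = u :=
  Function.leftInverse_invFun (embed_injective hj) u

theorem toH_embedDual (hj : DenseRange P.j) (h : LpTime T 2 H) : P.toH (P.embedDual h) = h :=
  Function.leftInverse_invFun (embedDual_injective hj) h

/-! ### Monotonicity of the evolution operators -/

theorem timeDeriv_Mdual_nonneg (hM : ∀ x, 0 ≤ inner ℝ (P.M x) x)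
    (hsymm : ∀ x y, inner ℝ (P.M x) y = inner ℝ (P.M y) x) {w : LpTime T p V} (hw : w ∈ P.W) :
    0 ≤ timeDeriv (P.Mdual w) w := by
  have hlim : Tendsto (fun τ : ℝ => (τ⁻¹ • (P.Mdual w - translation τ (P.Mdual w))) w)
      (𝓝[>] 0) (𝓝 (timeDeriv (P.Mdual w) w)) :=
    ((ContinuousLinearMap.apply ℝ ℝ w).continuous.tendsto _).comp (hasTimeDeriv_timeDeriv hw)
  refine ge_of_tendsto hlim ?_
  filter_upwards [self_mem_nhdsWithin] with τ hτ
  have h := inner_induced_leftShift_le P.M hM hsymm τ (P.embed w)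
  rw [← embed_leftShift] at h
  rw [smul_apply, sub_apply, smul_eq_mul]
  exact mul_nonneg (inv_nonneg.2 (le_of_lt hτ)) (sub_nonneg.2 h)

theorem IsProper.kMonotone_cauchyOp {k : LpTime T p V → ℝ≥0} (hP : P.IsProper k)
    {v w : LpTime T p V} (hv : v ∈ P.W) (hw : w ∈ P.W) :
    (k (v - w) : ℝ) ≤ (P.cauchyOp v - P.cauchyOp w) (v - w) := by
  have hd : HasTimeDeriv (P.Mdual (v - w)) (timeDeriv (P.Mdual v) - timeDeriv (P.Mdual w)) := by
    rw [Mdual_sub]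
    exact (hasTimeDeriv_timeDeriv hv).sub (hasTimeDeriv_timeDeriv hw)
  have h1 := timeDeriv_Mdual_nonneg hP.M_monotone hP.M_symmetric (w := v - w) ⟨_, hd⟩
  rw [hd.timeDeriv_eq] at h1
  have h2 := hP.A_kMonotone v w
  have h3 : P.cauchyOp v - P.cauchyOp w =
      (timeDeriv (P.Mdual v) - timeDeriv (P.Mdual w)) + (P.A v - P.A w) := by
    simp only [cauchyOp]
    abel
  rw [h3, add_apply]
  linarith

end CauchyProblem

/-- The operator `ℱ_ℓ` inherits the `k_ℓ`-monotonicity of `𝒜_ℓ`, because `E_ℓ` is adjoint to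
`R_ℓ`. -/
theorem kMonotone_subOp {T : ℝ} {p : ℝ≥0∞} [Fact (2 ≤ p)] {H H' V' : Type*}
    [NormedAddCommGroup H] [InnerProductSpace ℝ H]
    [NormedAddCommGroup H'] [InnerProductSpace ℝ H'] [NormedAddCommGroup V'] [NormedSpace ℝ V']
    {Q : CauchyProblem T p H' V'} {k : LpTime T p V' → ℝ≥0} (hQ : Q.IsProper k)
    {E : H' →L[ℝ] H} {R : H →L[ℝ] H'} (hER : ∀ x y, inner ℝ (E x) y = inner ℝ x (R y))
    {x y : LpTime T 2 H} (hx : x ∈ subDomain Q R) (hy : y ∈ subDomain Q R) :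
    (k (Q.toV (induced T 2 R (x - y))) : ℝ) ≤
      inner ℝ (subOp Q E R x - subOp Q E R y) (x - y) := by
  obtain ⟨v, hv, hvx, g, hg⟩ := hx
  obtain ⟨w, hw, hwy, h, hh⟩ := hy
  have key := hQ.kMonotone_cauchyOp hv hw
  rw [← hg, ← hh, ← Q.embedDual_sub, Q.embedDual_apply] at key
  simp only [subOp, ← hvx, ← hwy, Q.toV_embed hQ.embedding_injective]
  rw [← hg, ← hh, Q.toH_embedDual hQ.embedding_dense, Q.toH_embedDual hQ.embedding_dense,
    ← map_sub, inner_induced_left E R hER, map_sub, ← hvx, ← hwy, ← map_sub,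
    Q.toV_embed hQ.embedding_injective]
  exact key

/-! ### Convergence of the splitting schemes -/

/-- A nonnegative sequence that bounds the decrease of another nonnegative sequence tends
to `0`. -/
theorem tendsto_zero_of_add_le {a c : ℕ → ℝ} (ha : ∀ n, 0 ≤ a n) (hc : ∀ n, 0 ≤ c n)
    (h : ∀ n, a (n + 1) + c n ≤ a n) : Tendsto c atTop (𝓝 0) := by
  refine (summable_of_sum_range_le (c := a 0) hc fun n => ?_).tendsto_atTop_zero
  suffices (∑ i ∈ Finset.range n, c i) + a n ≤ a 0 from by linarith [ha n]
  induction n with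
  | zero => simp
  | succ n ih =>
    rw [Finset.sum_range_succ]
    linarith [h n]

section Splitting

variable {X : Type*} [NormedAddCommGroup X] [InnerProductSpace ℝ X] {s : ℝ} {D₁ D₂ : Set X}
  {F₁ F₂ : X → X} {u₁ u₂ : ℕ → X} {u : X}

theorem IsPeacemanRachford.norm_sq_add_le (h : IsPeacemanRachford s D₁ D₂ F₁ F₂ u₁ u₂)
    (hu : F₁ u + F₂ u = 0) (n : ℕ) :
    ‖s • (u₂ (n + 1) - u) + (F₂ (u₂ (n + 1)) - F₂ u)‖ ^ 2 +
      4 * s * (inner ℝ (F₁ (u₁ (n + 1)) - F₁ u) (u₁ (n + 1) - u) +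
        inner ℝ (F₂ (u₂ n) - F₂ u) (u₂ n - u)) ≤
      ‖s • (u₂ n - u) + (F₂ (u₂ n) - F₂ u)‖ ^ 2 := by
  set a := u₁ (n + 1) - u with ha
  set b := u₂ n - u with hb
  set A := F₁ (u₁ (n + 1)) - F₁ u with hA
  set B := F₂ (u₂ n) - F₂ u with hB
  have e1 : s • a + A = s • b - B := by
    have h1 := h.step₁ n
    have : s • a + A - (s • b - B) = (s • u₁ (n + 1) + F₁ (u₁ (n + 1))) -
        (s • u₂ n - F₂ (u₂ n)) - (F₁ u + F₂ u) := by
      rw [ha, hb, hA, hB]; module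
    rw [← sub_eq_zero, this, h1, hu]; simp
  have e2 : s • (u₂ (n + 1) - u) + (F₂ (u₂ (n + 1)) - F₂ u) = s • a - A := by
    have h1 := h.step₂ n
    have : s • (u₂ (n + 1) - u) + (F₂ (u₂ (n + 1)) - F₂ u) - (s • a - A) =
        (s • u₂ (n + 1) + F₂ (u₂ (n + 1))) - (s • u₁ (n + 1) - F₁ (u₁ (n + 1))) -
          (F₁ u + F₂ u) := by
      rw [ha, hA]; module
    rw [← sub_eq_zero, this, h1, hu]; simp
  clear_value a b A B
  have e3 : ‖s • a + A‖ ^ 2 = ‖s • b - B‖ ^ 2 := by rw [e1]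
  rw [e2]
  rw [norm_add_sq_real, norm_sub_sq_real, inner_smul_left, inner_smul_left] at e3
  rw [norm_sub_sq_real, norm_add_sq_real, inner_smul_left, inner_smul_left]
  simp only [conj_trivial] at e3 ⊢
  rw [real_inner_comm a A, real_inner_comm b B]
  linarith

theorem IsDouglasRachford.norm_sq_add_le (h : IsDouglasRachford s D₁ D₂ F₁ F₂ u₁ u₂)
    (hu : F₁ u + F₂ u = 0) (n : ℕ) :
    ‖s • (u₂ (n + 1) - u) + (F₂ (u₂ (n + 1)) - F₂ u)‖ ^ 2 +
      2 * s * (inner ℝ (F₁ (u₁ (n + 1)) - F₁ u) (u₁ (n + 1) - u) +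
        inner ℝ (F₂ (u₂ n) - F₂ u) (u₂ n - u)) ≤
      ‖s • (u₂ n - u) + (F₂ (u₂ n) - F₂ u)‖ ^ 2 := by
  set a := u₁ (n + 1) - u with ha
  set b := u₂ n - u with hb
  set A := F₁ (u₁ (n + 1)) - F₁ u with hA
  set B := F₂ (u₂ n) - F₂ u with hB
  have e1 : s • b = s • a + A + B := by
    have h1 := h.step₁ n
    have : s • b - (s • a + A + B) = (s • u₂ n - F₂ (u₂ n)) -
        (s • u₁ (n + 1) + F₁ (u₁ (n + 1))) + (F₁ u + F₂ u) := by
      rw [ha, hb, hA, hB]; module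
    rw [← sub_eq_zero, this, h1, hu]; simp
  have e2 : s • (u₂ (n + 1) - u) + (F₂ (u₂ (n + 1)) - F₂ u) = s • a + B := by
    have h1 := h.step₂ n
    have : s • (u₂ (n + 1) - u) + (F₂ (u₂ (n + 1)) - F₂ u) - (s • a + B) =
        (s • u₂ (n + 1) + F₂ (u₂ (n + 1))) - (s • u₁ (n + 1) + F₂ (u₂ n)) := by
      rw [ha, hB]; module
    rw [← sub_eq_zero, this, h1, sub_self]
  clear_value a b A B
  have e3 : s * inner ℝ B b = s * inner ℝ B a + inner ℝ A B + ‖B‖ ^ 2 := by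
    rw [← real_inner_smul_right, ← real_inner_smul_right, e1, inner_add_right,
      inner_add_right, real_inner_self_eq_norm_sq, real_inner_comm A B]
  -- The gap between the two sides is `‖A + B‖²`.
  have e4 := norm_add_sq_real A B
  have e5 := sq_nonneg ‖A + B‖
  have e6 : s • b + B = (s • a + B) + (A + B) := by rw [e1]; abel
  rw [e2, e6, norm_add_sq_real (s • a + B) (A + B), inner_add_left, inner_add_right B A B,
    inner_smul_left, inner_add_right a, real_inner_self_eq_norm_sq, real_inner_comm A a,
    real_inner_comm B a, real_inner_comm A B]
  simp only [conj_trivial]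
  linarith

/-- Convergence of both splitting schemes in a Hilbert space, measured by functions that are
dominated by the monotonicity pairings. -/
theorem tendsto_of_splitting (hs : 0 < s) (h_init : u₂ 0 ∈ D₂)
    (h : IsPeacemanRachford s D₁ D₂ F₁ F₂ u₁ u₂ ∨ IsDouglasRachford s D₁ D₂ F₁ F₂ u₁ u₂)
    (hu : F₁ u + F₂ u = 0) {κ₁ κ₂ : X → ℝ} (hκ₁ : ∀ x, 0 ≤ κ₁ x) (hκ₂ : ∀ x, 0 ≤ κ₂ x)
    (hF₁ : ∀ x ∈ D₁, κ₁ x ≤ inner ℝ (F₁ x - F₁ u) (x - u))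
    (hF₂ : ∀ x ∈ D₂, κ₂ x ≤ inner ℝ (F₂ x - F₂ u) (x - u)) :
    Tendsto (fun n => κ₁ (u₁ n) + κ₂ (u₂ n)) atTop (𝓝 0) := by
  have hmem₁ : ∀ n, u₁ (n + 1) ∈ D₁ := h.elim (·.mem₁) (·.mem₁)
  have hmem₂ : ∀ n, u₂ n ∈ D₂ := by
    rintro (_ | n)
    · exact h_init
    · exact h.elim (·.mem₂ n) (·.mem₂ n)
  have hc : ∀ n, 0 ≤ κ₁ (u₁ (n + 1)) + κ₂ (u₂ n) := fun n => add_nonneg (hκ₁ _) (hκ₂ _)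
  -- The half-steps `u₁ (n + 1)` and `u₂ n` are coupled by the energy estimate; the index of `u₁`
  -- is shifted back at the end.
  have hlim : Tendsto (fun n => 2 * s * (κ₁ (u₁ (n + 1)) + κ₂ (u₂ n))) atTop (𝓝 0) := by
    refine tendsto_zero_of_add_le
      (a := fun n => ‖s • (u₂ n - u) + (F₂ (u₂ n) - F₂ u)‖ ^ 2)
      (fun n => sq_nonneg _) (fun n => mul_nonneg (by positivity) (hc n)) fun n => ?_
    have hle := add_le_add (hF₁ _ (hmem₁ n)) (hF₂ _ (hmem₂ n))
    have hle' := mul_le_mul_of_nonneg_left hle hs.le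
    have hpos := mul_nonneg hs.le (hc n)
    rcases h with h | h
    · linarith [h.norm_sq_add_le hu n]
    · linarith [h.norm_sq_add_le hu n]
  have hlim' : Tendsto (fun n => κ₁ (u₁ (n + 1)) + κ₂ (u₂ n)) atTop (𝓝 0) := by
    have h2s : 2 * s ≠ 0 := by positivity
    simpa only [inv_mul_cancel_left₀ h2s, mul_zero] using hlim.const_mul (2 * s)⁻¹
  have h1 : Tendsto (fun n => κ₁ (u₁ n)) atTop (𝓝 0) :=
    (tendsto_add_atTop_iff_nat 1).1 <| squeeze_zero (fun n => hκ₁ _)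
      (fun n => le_add_of_nonneg_right (hκ₂ (u₂ n))) hlim'
  have h2 : Tendsto (fun n => κ₂ (u₂ n)) atTop (𝓝 0) :=
    squeeze_zero (fun n => hκ₂ _) (fun n => le_add_of_nonneg_left (hκ₁ (u₁ (n + 1)))) hlim'
  simpa using h1.add h2

end Splitting

end SchwarzLike

theorem mainTheorem1 {T : ℝ} (hT : 0 < T) {p : ℝ≥0∞} [Fact (2 ≤ p)] (hp : p ≠ ∞)
    {H V : Type*} [NormedAddCommGroup H] [InnerProductSpace ℝ H] [CompleteSpace H]
    [NormedAddCommGroup V] [NormedSpace ℝ V] [CompleteSpace V]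
    {Hl Vl : Fin 2 → Type*}
    [∀ ℓ, NormedAddCommGroup (Hl ℓ)] [∀ ℓ, InnerProductSpace ℝ (Hl ℓ)] [∀ ℓ, CompleteSpace (Hl ℓ)]
    [∀ ℓ, NormedAddCommGroup (Vl ℓ)] [∀ ℓ, NormedSpace ℝ (Vl ℓ)] [∀ ℓ, CompleteSpace (Vl ℓ)]
    (P : SchwarzLike.CauchyProblem T p H V)
    (Q : ∀ ℓ, SchwarzLike.CauchyProblem T p (Hl ℓ) (Vl ℓ))
    (E : ∀ ℓ, Hl ℓ →L[ℝ] H) (R : ∀ ℓ, H →L[ℝ] Hl ℓ)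
    (k₀ : SchwarzLike.LpTime T p V → ℝ≥0) (k : ∀ ℓ, SchwarzLike.LpTime T p (Vl ℓ) → ℝ≥0)
    (hproper : SchwarzLike.ProperDecomposition P Q E R k₀ k)
    (hspaces : SchwarzLike.CompatibleSpaces P Q R)
    (hsum : SchwarzLike.SumIdentity P Q E R)
    (u : SchwarzLike.LpTime T p V) (hu : P.IsSolution u)
    (hreg : ∀ ℓ, P.embed u ∈ SchwarzLike.subDomain (Q ℓ) (R ℓ))
    (s : ℝ) (hs : 0 < s) (u₁ u₂ : ℕ → SchwarzLike.LpTime T 2 H)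
    (h_init : u₂ 0 ∈ SchwarzLike.subDomain (Q 1) (R 1))
    (h_scheme :
      SchwarzLike.IsPeacemanRachford s
          (SchwarzLike.subDomain (Q 0) (R 0)) (SchwarzLike.subDomain (Q 1) (R 1))
          (SchwarzLike.subOp (Q 0) (E 0) (R 0)) (SchwarzLike.subOp (Q 1) (E 1) (R 1)) u₁ u₂ ∨
      SchwarzLike.IsDouglasRachford s
          (SchwarzLike.subDomain (Q 0) (R 0)) (SchwarzLike.subDomain (Q 1) (R 1))
          (SchwarzLike.subOp (Q 0) (E 0) (R 0)) (SchwarzLike.subOp (Q 1) (E 1) (R 1)) u₁ u₂) :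
    Tendsto (fun n : ℕ =>
        (k 0 ((Q 0).toV (SchwarzLike.induced T 2 (R 0) (u₁ n - P.embed u))) : ℝ) +
          k 1 ((Q 1).toV (SchwarzLike.induced T 2 (R 1) (u₂ n - P.embed u))))
      atTop (𝓝 0) := by
  have hadj := hproper.adjoint
  have hzero : SchwarzLike.subOp (Q 0) (E 0) (R 0) (P.embed u) +
      SchwarzLike.subOp (Q 1) (E 1) (R 1) (P.embed u) = 0 := by
    have h := hsum u hu.1 hreg
    rw [hu.2, Fin.sum_univ_two] at h
    refine SchwarzLike.CauchyProblem.embedDual_injective hproper.proper.embedding_dense ?_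
    rw [← h]
    ext v
    rw [P.embedDual_apply, inner_zero_left, zero_apply]
  exact SchwarzLike.tendsto_of_splitting hs h_init h_scheme hzero
    (κ₁ := fun x => (k 0 ((Q 0).toV (SchwarzLike.induced T 2 (R 0) (x - P.embed u))) : ℝ))
    (κ₂ := fun x => (k 1 ((Q 1).toV (SchwarzLike.induced T 2 (R 1) (x - P.embed u))) : ℝ))
    (fun _ => NNReal.coe_nonneg _) (fun _ => NNReal.coe_nonneg _)
    (fun _ hx => SchwarzLike.kMonotone_subOp (hproper.proper_sub 0) (hadj 0) hx (hreg 0))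
    (fun _ hx => SchwarzLike.kMonotone_subOp (hproper.proper_sub 1) (hadj 1) hx (hreg 1))
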